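/- Let $d\ge 3$ be an integer, write $\langle v\rangle=\sqrt{1+|v|^2}$ for $v\in\mathbb R^d$, and for $p\ge 1$, $k\in\mathbb R$ set $\|f\|_{L^p_k}=\left(\int_{\mathbb R^d}|f(v)|^p\langle v\rangle^k\,dv\right)^{1/p}$ and $\|f\|_1=\|f\|_{L^1_0}$. For $\gamma\in[-d,0)$ let $$c_\gamma[g](v)=-(d-1)(\gamma+d)\int_{\mathbb R^d}|v-w|^\gamma g(w)\,dw\quad(-d<\gamma<0),\qquad c_{-d}[g](v)=-(d-1)(d-2)|\mathbb S^{d-1}|\,g(v).$$ (1) Let $-d<\gamma<0$, let $q\ge 1$ satisfy $\frac{d}{d+2+\gamma}<q<\frac{d}{d+\gamma}$, and put $s=\frac{d-q(d+\gamma)}{2q}$. Then $s\in(0,1)$, and there is a constant $C_0>0$ depending only on $d,\gamma,q$ such that, for every measurable $\phi:\mathbb R^d\to\mathbb R$ with $\langle\cdot\rangle^{\gamma/2}\phi\in H^1(\mathbb R^d)$ and every $g\ge 0$ in $L^1(\mathbb R^d)\cap L^q_{q|\gamma|}(\mathbb R^d)$, the integral defining $c_\gamma[g](v)$ converges for almost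 every $v$, the function $\phi^2c_\gamma[g]$ is integrable, and for every $\varepsilon>0$ $$-\int_{\mathbb R^d}\phi^2c_\gamma[g]\,dv\le\varepsilon\int_{\mathbb R^d}\left|\nabla\left(\langle v\rangle^{\gamma/2}\phi(v)\right)\right|^2dv+C_0\left(\|g\|_1+\varepsilon^{-\frac{s}{1-s}}\|g\|_{L^q_{q|\gamma|}}^{\frac1{1-s}}\right)\int_{\mathbb R^d}\phi^2\langle v\rangle^\gamma\,dv,$$ where $\nabla$ is the weak gradient. (2) Let $\gamma=-d$ and $\frac d2<q<\infty$. Then there is a constant $C_0>0$ depending only on $d,q$ such that, for every measurable $\phi:\mathbb R^d\to\mathbb R$ with $\langle\cdot\rangle^{-d/2}\phi\in H^1(\mathbb R^d)$ and every $g\ge 0$ in $L^q_{qd}(\mathbb R^d)$, the function $\phi^2c_{-d}[g]$ is integrable, and for every $\varepsilon>0$ $$-\int_{\mathbb R^d}\phi^2c_{-d}[g]\,dv\le\varepsilon\int_{\mathbb R^d}\left|\nabla\left(\langle v\rangle^{-d/2}\phi(v)\right)\right|^2dv+C_0\,\varepsilon^{-\frac{d}{2q-d}}\|g\|_{L^q_{qd}}^{\frac{2q}{2q-d}}\int_{\mathbb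 R^d}\phi^2\langle v\rangle^{-d}\,dv.$$ -/

import Mathlib

open MeasureTheory
open scoped ContDiff

noncomputable section

namespace Landau

/-- The Japanese bracket `⟨v⟩ = √(1 + |v|²)`. -/
def bracket {d : ℕ} (v : EuclideanSpace ℝ (Fin d)) : ℝ :=
  Real.sqrt (1 + ‖v‖ ^ 2)

/-- Membership in the weighted Lebesgue space `L^p_k`:
`f` is measurable and `∫ |f|^p ⟨v⟩^k dv < ∞`. -/
def MemWeightedLp {d : ℕ} (p k : ℝ) (f : EuclideanSpace ℝ (Fin d) → ℝ) : Prop :=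
  AEStronglyMeasurable f volume ∧
    Integrable (fun v => |f v| ^ p * bracket v ^ k) volume

/-- The norm `‖f‖_{L^p_k} = (∫ |f|^p ⟨v⟩^k dv)^{1/p}`. -/
def weightedLpNorm {d : ℕ} (p k : ℝ) (f : EuclideanSpace ℝ (Fin d) → ℝ) : ℝ :=
  (∫ v, |f v| ^ p * bracket v ^ k) ^ (1 / p)

/-- The surface measure `|𝕊^{d-1}|` of the unit sphere of `ℝ^d`. -/
def sphereArea (d : ℕ) : ℝ :=
  (volume : Measure (EuclideanSpace ℝ (Fin d))).toSphere.real Set.univ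

/-- The coefficient `c_γ[f]`, for `-d ≤ γ < 0`:
`c_γ[f](v) = -(d-1)(γ+d) ∫ |v-w|^γ f(w) dw` if `γ > -d`, and
`c_{-d}[f] = -(d-1)(d-2)|𝕊^{d-1}| f` in the Coulomb case. -/
def cCoeff {d : ℕ} (γ : ℝ) (f : EuclideanSpace ℝ (Fin d) → ℝ)
    (v : EuclideanSpace ℝ (Fin d)) : ℝ :=
  if γ = -(d : ℝ) then
    -(((d : ℝ) - 1) * ((d : ℝ) - 2) * sphereArea d) * f v
  else
    -(((d : ℝ) - 1) * (γ + d)) * ∫ w, ‖v - w‖ ^ γ * f w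

/-- `G` is the weak (distributional) gradient of `u` on `ℝ^d`. -/
structure HasWeakGradient {d : ℕ} (u : EuclideanSpace ℝ (Fin d) → ℝ)
    (G : EuclideanSpace ℝ (Fin d) → EuclideanSpace ℝ (Fin d)) : Prop where
  locallyIntegrable_fun : LocallyIntegrable u volume
  locallyIntegrable_grad : LocallyIntegrable G volume
  integral_eq : ∀ η : EuclideanSpace ℝ (Fin d) → ℝ, ContDiff ℝ ∞ η → HasCompactSupport η →
    ∀ i : Fin d,
      ∫ v, u v * fderiv ℝ η v (EuclideanSpace.single i 1) = -∫ v, G v i * η v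

/-- `u ∈ H¹(ℝ^d)`, with weak gradient `G`. -/
def IsH1WithGradient {d : ℕ} (u : EuclideanSpace ℝ (Fin d) → ℝ)
    (G : EuclideanSpace ℝ (Fin d) → EuclideanSpace ℝ (Fin d)) : Prop :=
  MemLp u 2 volume ∧ MemLp G 2 volume ∧ HasWeakGradient u G

end Landau

end

noncomputable section

namespace Landau

open Filter Topology ENNReal NNReal

variable {d : ℕ}

local notation "𝔼" => EuclideanSpace ℝ (Fin d)

/-! Put `u = ⟨v⟩^{γ/2} φ`, so that `φ² = ⟨v⟩^{-γ} u²`. All bounds are proved for the integral of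
`|φ² c_γ[g]|`, which gives integrability together with the estimate.

For `-d < γ < 0` the weight is removed first (`bracket_rpow_mul_norm_sub_rpow_le`). If `|v - w| ≥
⟨v⟩/2`, the kernel cancels `⟨v⟩^{-γ}` and leaves the `‖g‖₁` term; otherwise `⟨v⟩ ≤ 2⟨w⟩` and the
weight passes to `h = ⟨w⟩^{-γ} |g|`, whose `L^q` norm is the weighted norm of `g`. What remains is
the Riesz form `∬ u²(v) |v - w|^γ h(w)`.

By Young's inequality and the Sobolev bound for `u²` interpolated with parameter `θ`, a kernel cut
off at length `R` costs `R^{2θ-2s} X^{1-θ} (SY)^θ`, where `X = ∫u²` and `Y = ∫|∇u|²`. The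
scale-invariant value `θ = s` is never used: the part `|v - w| < R` has a finite norm for some `θ >
s`, the rest for some `θ < s`. Both costs are at most `R^{-2s}(X + R² S Y)`, and this argument
includes `q = 1`, where the Hardy-Littlewood-Sobolev inequality fails. Choosing `R` so that the
gradient term equals `εY` (`le_of_forall_scale`) gives the powers of `ε` and of the norm.

For `γ = -d` the form is local: Hölder replaces Young, with `θ = s = d/(2q)`, and the same choice of
`R` concludes. -/

/-! ### Mollification and the Sobolev inequality in `H¹`. -/

/-- Averaging against a probability density is a contraction of `L²`. -/
theorem lintegral_sq_lconvolution_le {ρ N : 𝔼 → ℝ≥0∞} (hρ : Measurable ρ)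
    (hN : AEMeasurable N volume) (h1 : ∫⁻ y, ρ y = 1) :
    ∫⁻ x, (∫⁻ y, ρ y * N (x - y)) ^ 2 ≤ ∫⁻ x, N x ^ 2 := by
  have hmeas : AEMeasurable (fun z : 𝔼 × 𝔼 => N (z.1 - z.2)) (volume.prod volume) :=
    hN.comp_quasiMeasurePreserving (quasiMeasurePreserving_sub volume volume)
  have hsub (x : 𝔼) : AEMeasurable (fun y => N (x - y)) volume :=
    hN.comp_quasiMeasurePreserving (quasiMeasurePreserving_sub_left volume x)
  calc ∫⁻ x, (∫⁻ y, ρ y * N (x - y)) ^ 2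
      ≤ ∫⁻ x, ∫⁻ y, ρ y * N (x - y) ^ 2 := by
        refine lintegral_mono fun x => ?_
        -- Cauchy-Schwarz for `ρ N = ρ^{1/2} (ρ N²)^{1/2}`; the first factor has unit mass.
        have key := ENNReal.lintegral_mul_norm_pow_le (μ := (volume : Measure 𝔼))
          (f := ρ) (g := fun y => ρ y * N (x - y) ^ 2) hρ.aemeasurable
          (hρ.aemeasurable.mul ((hsub x).pow_const 2)) (p := 1 / 2) (q := 1 / 2)
          (by norm_num) (by norm_num) (by norm_num)
        have hpt (y : 𝔼) : ρ y ^ (1 / 2 : ℝ) * (ρ y * N (x - y) ^ 2) ^ (1 / 2 : ℝ)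
            = ρ y * N (x - y) := by
          rw [ENNReal.mul_rpow_of_nonneg _ _ (by norm_num), ← mul_assoc,
            ← ENNReal.rpow_add_of_nonneg _ _ (by norm_num) (by norm_num),
            ← ENNReal.rpow_natCast, ← ENNReal.rpow_mul]
          norm_num
        simp only [hpt, h1, ENNReal.one_rpow, one_mul] at key
        calc (∫⁻ y, ρ y * N (x - y)) ^ 2
            ≤ ((∫⁻ y, ρ y * N (x - y) ^ 2) ^ (1 / 2 : ℝ)) ^ 2 := by gcongr
          _ = _ := by
            rw [← ENNReal.rpow_natCast, ← ENNReal.rpow_mul]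
            norm_num
    _ = ∫⁻ y, ∫⁻ x, ρ y * N (x - y) ^ 2 := by
        refine lintegral_lintegral_swap ?_
        exact (hρ.comp measurable_snd).aemeasurable.mul (hmeas.pow_const 2)
    _ = ∫⁻ y, ρ y * ∫⁻ x, N x ^ 2 := by
        refine lintegral_congr fun y => ?_
        have hy : AEMeasurable (fun x => N (x - y)) volume := hN.comp_quasiMeasurePreserving
          (measurePreserving_sub_right volume y).quasiMeasurePreserving
        rw [lintegral_const_mul'' _ (hy.pow_const 2), lintegral_sub_right_eq_self (fun x => N x ^ 2) y]
    _ = ∫⁻ x, N x ^ 2 := by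
        rw [lintegral_mul_const _ hρ, h1, one_mul]

/-- The Sobolev inequality for `C¹` functions of class `H¹`, without support restrictions. -/
theorem eLpNorm_le_eLpNorm_fderiv_of_memLp (hd : 3 ≤ d) {p' : ℝ≥0}
    (hp' : (p' : ℝ)⁻¹ = 2⁻¹ - (d : ℝ)⁻¹) {u : 𝔼 → ℝ} (hu : ContDiff ℝ 1 u)
    (hu2 : MemLp u 2 volume) :
    eLpNorm u p' volume ≤
      eLpNormLESNormFDerivOfEqInnerConst (volume : Measure 𝔼) 2 *
        eLpNorm (fderiv ℝ u) 2 volume := by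
  set C := eLpNormLESNormFDerivOfEqInnerConst (volume : Measure 𝔼) 2
  let χ : ContDiffBump (0 : 𝔼) := ⟨1, 2, one_pos, one_lt_two⟩
  have hχ : ContDiff ℝ 1 χ := χ.contDiff
  obtain ⟨M, hM⟩ := (hχ.continuous_fderiv one_ne_zero).bounded_above_of_compact_support
    (χ.hasCompactSupport.fderiv ℝ)
  have hM0 : 0 ≤ M := (norm_nonneg _).trans (hM 0)
  let t : ℕ → ℝ := fun n => ((n : ℝ) + 1)⁻¹
  have ht (n : ℕ) : 0 < t n := by positivity
  have htlim : Tendsto t atTop (𝓝 0) := by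
    simpa [t, one_div] using tendsto_one_div_add_atTop_nhds_zero_nat (𝕜 := ℝ)
  let f : ℕ → 𝔼 → ℝ := fun n x => χ (t n • x) * u x
  have hχn (n : ℕ) : ContDiff ℝ 1 fun x : 𝔼 => χ (t n • x) :=
    hχ.comp (contDiff_const_smul (t n))
  have hfC (n : ℕ) : ContDiff ℝ 1 (f n) := (hχn n).mul hu
  have hsupp (n : ℕ) : HasCompactSupport (f n) :=
    HasCompactSupport.mul_right (f := fun x : 𝔼 => χ (t n • x))
      (χ.hasCompactSupport.comp_smul (ht n).ne')
  have hlim : ∀ x, Tendsto (fun n => f n x) atTop (𝓝 (u x)) := by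
    intro x
    have h1 : Tendsto (fun n => χ (t n • x)) atTop (𝓝 (χ 0)) := by
      refine (χ.continuous.tendsto 0).comp ?_
      simpa using htlim.smul_const x
    have h2 : χ (0 : 𝔼) = 1 := χ.one_of_mem_closedBall (by simp [χ])
    simpa [f, h2] using h1.mul_const (u x)
  -- A derivative falling on the dilated cutoff gains the factor `t n`, so this error vanishes in
  -- the limit because `u` is in `L²`.
  have hder (n : ℕ) (x : 𝔼) :
      ‖fderiv ℝ (f n) x‖ ≤ ‖fderiv ℝ u x‖ + ‖(t n * M) • u x‖ := by
    have hc : HasFDerivAt (fun x : 𝔼 => χ (t n • x))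
        ((fderiv ℝ χ (t n • x)).comp (t n • ContinuousLinearMap.id ℝ 𝔼)) x := by
      refine ((hχ.differentiable one_ne_zero) (t n • x)).hasFDerivAt.comp x ?_
      exact (hasFDerivAt_id x).const_smul (t n)
    have hm := hc.mul ((hu.differentiable one_ne_zero) x).hasFDerivAt
    have he : fderiv ℝ (f n) x = _ := hm.fderiv
    rw [he]
    refine (norm_add_le _ _).trans ?_
    gcongr
    · rw [norm_smul, Real.norm_of_nonneg χ.nonneg]
      exact mul_le_of_le_one_left (norm_nonneg _) χ.le_one
    · rw [norm_smul, norm_smul, Real.norm_of_nonneg (by positivity : 0 ≤ t n * M), mul_comm]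
      gcongr
      refine (ContinuousLinearMap.opNorm_comp_le _ _).trans ?_
      rw [norm_smul, Real.norm_of_nonneg (ht n).le, mul_comm]
      have h1 := ContinuousLinearMap.norm_id_le (𝕜 := ℝ) (E := 𝔼)
      calc t n * ‖ContinuousLinearMap.id ℝ 𝔼‖ * ‖fderiv ℝ χ (t n • x)‖
          ≤ t n * 1 * M := by
            have := ht n
            gcongr
            exact hM _
        _ = t n * M := by ring
  have hnorm (n : ℕ) : eLpNorm (f n) p' volume ≤
      C * (eLpNorm (fderiv ℝ u) 2 volume +
        ENNReal.ofReal (t n * M) * eLpNorm u 2 volume) := by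
    have h1 := eLpNorm_le_eLpNorm_fderiv_of_eq_inner (volume : Measure 𝔼) (hfC n) (hsupp n)
      (p := 2) (p' := p') (by norm_num) (by simp; omega) (by simpa using hp')
    refine h1.trans ?_
    gcongr
    · norm_num; exact le_rfl
    · have hum : AEStronglyMeasurable (fun x => ‖fderiv ℝ u x‖) volume :=
        (hu.continuous_fderiv one_ne_zero).norm.aestronglyMeasurable
      have hum2 : AEStronglyMeasurable (fun x => ‖(t n * M) • u x‖) volume :=
        (hu.continuous.aestronglyMeasurable.const_smul (t n * M)).norm
      calc eLpNorm (fderiv ℝ (f n)) 2 volume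
          ≤ eLpNorm ((fun x => ‖fderiv ℝ u x‖) + fun x => ‖(t n * M) • u x‖) 2 volume :=
            eLpNorm_mono_real fun x => hder n x
        _ ≤ _ := eLpNorm_add_le hum hum2 (by norm_num)
        _ = _ := by
          rw [eLpNorm_norm, eLpNorm_norm]
          congr 1
          have := eLpNorm_const_smul (t n * M) u 2 (volume : Measure 𝔼)
          rw [← ofReal_norm, Real.norm_of_nonneg
            (mul_nonneg (ht n).le hM0)] at this
          exact this
  have hrhs : Tendsto (fun n => C * (eLpNorm (fderiv ℝ u) 2 volume +
        ENNReal.ofReal (t n * M) * eLpNorm u 2 volume)) atTop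
      (𝓝 (C * eLpNorm (fderiv ℝ u) 2 volume)) := by
    refine ENNReal.Tendsto.const_mul ?_ (Or.inr ENNReal.coe_ne_top)
    have h0 : Tendsto (fun n => ENNReal.ofReal (t n * M)) atTop (𝓝 0) := by
      have := ENNReal.tendsto_ofReal (htlim.mul_const M)
      simpa using this
    have h1 := ENNReal.Tendsto.mul_const h0 (Or.inr hu2.2.ne) (b := eLpNorm u 2 volume)
    simpa using tendsto_const_nhds.add h1
  calc eLpNorm u p' volume
      ≤ atTop.liminf fun n => eLpNorm (f n) p' volume :=
        Lp.eLpNorm_lim_le_liminf_eLpNorm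
          (fun n => (hfC n).continuous.aestronglyMeasurable) u (ae_of_all _ hlim)
    _ ≤ atTop.liminf fun n => C * (eLpNorm (fderiv ℝ u) 2 volume +
        ENNReal.ofReal (t n * M) * eLpNorm u 2 volume) :=
        liminf_le_liminf (Eventually.of_forall hnorm)
    _ = _ := hrhs.liminf_eq

/-- Mollification preserves the `L²` bound. -/
theorem eLpNorm_two_le_of_enorm_le_integral_bump {F V : Type*} [NormedAddCommGroup F]
    [NormedAddCommGroup V]
    (ψ : ContDiffBump (0 : 𝔼)) {f : 𝔼 → F} {N : 𝔼 → V} (hN : AEStronglyMeasurable N volume)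
    (hf : ∀ x, ‖f x‖ₑ ≤ ∫⁻ t, ‖ψ.normed volume (x - t)‖ₑ * ‖N t‖ₑ) :
    eLpNorm f 2 volume ≤ eLpNorm N 2 volume := by
  have hρ : Measurable fun y => ‖ψ.normed volume y‖ₑ := ψ.continuous_normed.measurable.enorm
  have h1 : ∫⁻ y, ‖ψ.normed volume y‖ₑ = 1 := by
    have := ofReal_integral_eq_lintegral_ofReal (ψ.integrable_normed (μ := volume))
      (ae_of_all _ ψ.nonneg_normed)
    rw [ψ.integral_normed, ENNReal.ofReal_one] at this
    rw [this]
    exact lintegral_congr fun y => Real.enorm_of_nonneg (ψ.nonneg_normed y)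
  have key := lintegral_sq_lconvolution_le hρ hN.enorm h1
  rw [eLpNorm_eq_lintegral_rpow_enorm_toReal (by norm_num) (by norm_num),
    eLpNorm_eq_lintegral_rpow_enorm_toReal (by norm_num) (by norm_num)]
  simp only [ENNReal.toReal_ofNat, ENNReal.rpow_ofNat]
  refine ENNReal.rpow_le_rpow ?_ (by norm_num)
  refine le_trans (lintegral_mono fun x => ?_) key
  gcongr
  refine (hf x).trans_eq ?_
  rw [← lintegral_sub_left_eq_self _ x]
  simp

/-- The gradient of a mollification is the mollification of the weak gradient. -/
theorem HasWeakGradient.fderiv_convolution {u : 𝔼 → ℝ} {G : 𝔼 → 𝔼} (h : HasWeakGradient u G)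
    (ψ : ContDiffBump (0 : 𝔼)) (x : 𝔼) :
    fderiv ℝ (convolution (ψ.normed volume) u (ContinuousLinearMap.lsmul ℝ ℝ) volume) x =
      innerSL ℝ (∫ t, ψ.normed volume (x - t) • G t) := by
  set ρ := ψ.normed (volume : Measure 𝔼)
  have hρ : ContDiff ℝ ∞ ρ := ψ.contDiff_normed
  have hρc : HasCompactSupport ρ := ψ.hasCompactSupport_normed
  have hflip : convolution ρ u (ContinuousLinearMap.lsmul ℝ ℝ) volume =
      convolution u ρ (ContinuousLinearMap.mul ℝ ℝ) volume := by
    funext y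
    rw [convolution_eq_swap, convolution_def]
    exact integral_congr_ae (ae_of_all _ fun t => by simp [mul_comm])
  have hder := hρc.hasFDerivAt_convolution_right (ContinuousLinearMap.mul ℝ ℝ)
    h.locallyIntegrable_fun (hρ.of_le (by norm_num)) x
  -- The reflected mollifier is the test function; the sign from reflection cancels the one from
  -- integration by parts.
  set η : 𝔼 → ℝ := fun t => ρ (x - t)
  have hη : ContDiff ℝ ∞ η := hρ.comp (contDiff_const.sub contDiff_id)
  have hηc : HasCompactSupport η := hρc.comp_homeomorph (Homeomorph.subLeft x)
  have hint : Integrable (fun t => η t • G t) volume :=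
    h.locallyIntegrable_grad.integrable_smul_left_of_hasCompactSupport hη.continuous hηc
  rw [hflip, hder.fderiv]
  refine ContinuousLinearMap.coe_injective
    ((EuclideanSpace.basisFun (Fin d) ℝ).toBasis.ext fun i => ?_)
  simp only [OrthonormalBasis.coe_toBasis, EuclideanSpace.basisFun_apply,
    ContinuousLinearMap.coe_coe, innerSL_apply_apply]
  rw [convolution_precompR_apply _ h.locallyIntegrable_fun (hρc.fderiv ℝ)
    (hρ.continuous_fderiv (by norm_num)), convolution_def, EuclideanSpace.inner_single_right]
  have hηd (t : 𝔼) : fderiv ℝ η t (EuclideanSpace.single i 1) =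
      -fderiv ℝ ρ (x - t) (EuclideanSpace.single i 1) := by
    have h1 : HasFDerivAt η _ t := ((hρ.differentiable (by norm_num)) (x - t)).hasFDerivAt.comp t
      ((hasFDerivAt_id t).const_sub x)
    rw [h1.fderiv]
    simp
  have hw := h.integral_eq η hη hηc i
  simp only [hηd, mul_neg, integral_neg, neg_inj] at hw
  have hproj := (EuclideanSpace.proj (𝕜 := ℝ) (i : Fin d)).integral_comp_comm hint
  simp only [PiLp.proj_apply, PiLp.smul_apply, smul_eq_mul] at hproj
  simp only [ContinuousLinearMap.mul_apply', hw, one_mul, conj_trivial]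
  rw [← hproj]
  exact integral_congr_ae (ae_of_all _ fun t => mul_comm _ _)

/-- The **Sobolev inequality** in `H¹(ℝ^d)`, `d ≥ 3`. -/
theorem IsH1WithGradient.eLpNorm_le (hd : 3 ≤ d) {p' : ℝ≥0}
    (hp' : (p' : ℝ)⁻¹ = 2⁻¹ - (d : ℝ)⁻¹) {u : 𝔼 → ℝ} {G : 𝔼 → 𝔼} (h : IsH1WithGradient u G) :
    eLpNorm u p' volume ≤
      eLpNormLESNormFDerivOfEqInnerConst (volume : Measure 𝔼) 2 * eLpNorm G 2 volume := by
  obtain ⟨hu, hG, hw⟩ := h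
  -- The fixed ratio 2 of outer to inner radius is what the almost everywhere convergence of
  -- mollifications of a locally integrable function requires.
  let ψ : ℕ → ContDiffBump (0 : 𝔼) := fun n =>
    ⟨((n : ℝ) + 1)⁻¹, 2 * ((n : ℝ) + 1)⁻¹, by positivity, by
      have : 0 < ((n : ℝ) + 1)⁻¹ := by positivity
      linarith⟩
  let f : ℕ → 𝔼 → ℝ := fun n =>
    convolution ((ψ n).normed volume) u (ContinuousLinearMap.lsmul ℝ ℝ) volume
  have hC (n : ℕ) : ContDiff ℝ 1 (f n) := by
    exact_mod_cast (ψ n).hasCompactSupport_normed.contDiff_convolution_left (n := 1)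
      (ContinuousLinearMap.lsmul ℝ ℝ) (ψ n).contDiff_normed hw.locallyIntegrable_fun
  have hL2 (n : ℕ) : eLpNorm (f n) 2 volume ≤ eLpNorm u 2 volume := by
    refine eLpNorm_two_le_of_enorm_le_integral_bump (ψ n) hu.1 fun x => ?_
    simp only [f, convolution_eq_swap]
    refine (enorm_integral_le_lintegral_enorm _).trans_eq ?_
    simp [enorm_mul]
  have hD (n : ℕ) : eLpNorm (fderiv ℝ (f n)) 2 volume ≤ eLpNorm G 2 volume := by
    refine eLpNorm_two_le_of_enorm_le_integral_bump (ψ n) hG.1 fun x => ?_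
    simp only [f]
    rw [hw.fderiv_convolution, ← ofReal_norm, innerSL_apply_norm, ofReal_norm]
    refine (enorm_integral_le_lintegral_enorm _).trans_eq ?_
    simp [enorm_smul]
  have hlim : ∀ᵐ x, Tendsto (fun n => f n x) atTop (𝓝 (u x)) := by
    refine ContDiffBump.ae_convolution_tendsto_right_of_locallyIntegrable (K := 2) ?_
      (Eventually.of_forall fun n => le_rfl) hw.locallyIntegrable_fun
    have := (tendsto_one_div_add_atTop_nhds_zero_nat (𝕜 := ℝ)).const_mul 2
    simpa [ψ, one_div] using this
  refine Lp.eLpNorm_le_of_ae_tendsto (u := atTop) (Eventually.of_forall fun n => ?_)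
    (fun n => (hC n).continuous.aestronglyMeasurable) hlim
  refine (eLpNorm_le_eLpNorm_fderiv_of_memLp hd hp' (hC n)
    ⟨(hC n).continuous.aestronglyMeasurable, (hL2 n).trans_lt hu.2⟩).trans ?_
  gcongr
  exact hD n

/-! ### Interpolation and Young's inequality. -/

/-- Log-convexity of Lebesgue norms between the exponents `1` and `m`. -/
theorem lintegral_rpow_interpolation {α : Type*} [MeasurableSpace α] {μ : Measure α}
    {F : α → ℝ≥0∞} (hF : AEMeasurable F μ) {m θ P : ℝ} (hm : 0 < m) (hθ0 : 0 ≤ θ) (hθ1 : θ ≤ 1)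
    (hP0 : 0 < P) (hP : P = 1 - θ + θ / m) :
    (∫⁻ x, F x ^ P⁻¹ ∂μ) ^ P ≤
      (∫⁻ x, F x ∂μ) ^ (1 - θ) * ((∫⁻ x, F x ^ m ∂μ) ^ m⁻¹) ^ θ := by
  have ha : 0 ≤ (1 - θ) / P := div_nonneg (by linarith) hP0.le
  have hb : 0 ≤ θ / m / P := by positivity
  have key := ENNReal.lintegral_mul_norm_pow_le hF (hF.pow_const m) ha hb
    (by rw [← add_div, ← hP, div_self hP0.ne'])
  have hpt (x : α) : F x ^ ((1 - θ) / P) * (F x ^ m) ^ (θ / m / P) = F x ^ P⁻¹ := by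
    rw [← ENNReal.rpow_mul, ← ENNReal.rpow_add_of_nonneg _ _ ha (by positivity)]
    congr 1
    field_simp
    ring
  simp only [hpt] at key
  refine (ENNReal.rpow_le_rpow key hP0.le).trans_eq ?_
  rw [ENNReal.mul_rpow_of_nonneg _ _ hP0.le, ← ENNReal.rpow_mul, ← ENNReal.rpow_mul,
    ← ENNReal.rpow_mul, div_mul_cancel₀ _ hP0.ne', div_mul_cancel₀ _ hP0.ne', div_eq_inv_mul]

/-- The trilinear form of **Young's convolution inequality**; the parameters are the inverses of
the Lebesgue exponents. -/
theorem lintegral_lintegral_mul_conv_le {F K h : 𝔼 → ℝ≥0∞} (hF : AEMeasurable F volume)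
    (hK : Measurable K) (hh : AEMeasurable h volume) {P B Q : ℝ} (hP0 : 0 < P) (hP1 : P ≤ 1)
    (hB0 : 0 < B) (hB1 : B ≤ 1) (hQ0 : 0 < Q) (hQ1 : Q ≤ 1) (hsum : P + B + Q = 2) :
    ∫⁻ x, ∫⁻ y, F x * K (x - y) * h y ≤
      (∫⁻ x, F x ^ P⁻¹) ^ P * (∫⁻ x, K x ^ B⁻¹) ^ B * (∫⁻ x, h x ^ Q⁻¹) ^ Q := by
  set f : 𝔼 × 𝔼 → ℝ≥0∞ := fun z => F z.1 ^ P⁻¹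
  set k : 𝔼 × 𝔼 → ℝ≥0∞ := fun z => K (z.1 - z.2) ^ B⁻¹
  set g : 𝔼 × 𝔼 → ℝ≥0∞ := fun z => h z.2 ^ Q⁻¹
  have hf : AEMeasurable f (volume.prod volume) := (hF.comp_fst).pow_const _
  have hg : AEMeasurable g (volume.prod volume) := (hh.comp_snd).pow_const _
  have hk : AEMeasurable k (volume.prod volume) :=
    ((hK.comp (measurable_fst.sub measurable_snd)).pow_const _).aemeasurable
  set A := ∫⁻ x, F x ^ P⁻¹
  set M := ∫⁻ x, K x ^ B⁻¹
  set H := ∫⁻ x, h x ^ Q⁻¹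
  have i0 : ∫⁻ z, f z * k z ∂(volume.prod volume) = A * M := by
    rw [lintegral_prod (fun z => f z * k z) (hf.mul hk)]
    simp only [f, k]
    have (x : 𝔼) : ∫⁻ y, F x ^ P⁻¹ * K (x - y) ^ B⁻¹ = F x ^ P⁻¹ * M := by
      have hKx : Measurable fun y => K (x - y) := hK.comp (measurable_const.sub measurable_id)
      rw [lintegral_const_mul _ (hKx.pow_const _),
        lintegral_sub_left_eq_self (fun y => K y ^ B⁻¹) x]
    simp only [this]
    rw [lintegral_mul_const'' _ (hF.pow_const _)]
  have i1 : ∫⁻ z, f z * g z ∂(volume.prod volume) = A * H :=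
    lintegral_prod_mul (hF.pow_const _) (hh.pow_const _)
  have i2 : ∫⁻ z, k z * g z ∂(volume.prod volume) = M * H := by
    rw [lintegral_prod_symm (fun z => k z * g z) (hk.mul hg)]
    simp only [g, k]
    have (y : 𝔼) : ∫⁻ x, K (x - y) ^ B⁻¹ * h y ^ Q⁻¹ = M * h y ^ Q⁻¹ := by
      have hKy : Measurable fun x => K (x - y) := hK.comp (measurable_id.sub measurable_const)
      rw [lintegral_mul_const _ (hKy.pow_const _),
        lintegral_sub_right_eq_self (fun y => K y ^ B⁻¹) y]
    simp only [this]
    rw [lintegral_const_mul'' _ (hh.pow_const _)]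
  have hQ' : 0 ≤ 1 - Q := by linarith
  have hB' : 0 ≤ 1 - B := by linarith
  have hP' : 0 ≤ 1 - P := by linarith
  -- Three-factor Hölder on the product space, applied to the pairs `fk`, `fg`, `kg`. Their
  -- exponents add up to 1 because `P + B + Q = 2`, and the integral of each pair factorizes by
  -- translation invariance.
  have key := ENNReal.lintegral_prod_norm_pow_le (μ := (volume : Measure 𝔼).prod volume)
    (Finset.univ : Finset (Fin 3))
    (f := ![fun z => f z * k z, fun z => f z * g z, fun z => k z * g z])
    (p := ![1 - Q, 1 - B, 1 - P])
    (by
      intro i _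
      fin_cases i
      · exact hf.mul hk
      · exact hf.mul hg
      · exact hk.mul hg)
    (by simp [Fin.sum_univ_three]; linarith)
    (by intro i _; fin_cases i <;> simpa)
  simp only [Fin.prod_univ_three, Matrix.cons_val_zero, Matrix.cons_val_one, Matrix.cons_val,
    i0, i1, i2] at key
  have collect (a b c : ℝ≥0∞) :
      (a * b) ^ (1 - Q) * (a * c) ^ (1 - B) * (b * c) ^ (1 - P) = a ^ P * b ^ B * c ^ Q := by
    have ea : a ^ P = a ^ (1 - Q) * a ^ (1 - B) := by
      rw [← ENNReal.rpow_add_of_nonneg _ _ hQ' hB']; congr 1; linarith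
    have eb : b ^ B = b ^ (1 - Q) * b ^ (1 - P) := by
      rw [← ENNReal.rpow_add_of_nonneg _ _ hQ' hP']; congr 1; linarith
    have ec : c ^ Q = c ^ (1 - B) * c ^ (1 - P) := by
      rw [← ENNReal.rpow_add_of_nonneg _ _ hB' hP']; congr 1; linarith
    rw [ENNReal.mul_rpow_of_nonneg _ _ hQ', ENNReal.mul_rpow_of_nonneg _ _ hB',
      ENNReal.mul_rpow_of_nonneg _ _ hP', ea, eb, ec]
    ring
  simp only [collect] at key
  have hpt (z : 𝔼 × 𝔼) : f z ^ P * k z ^ B * g z ^ Q = F z.1 * K (z.1 - z.2) * h z.2 := by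
    simp only [f, k, g, ← ENNReal.rpow_mul]
    rw [inv_mul_cancel₀ hP0.ne', inv_mul_cancel₀ hB0.ne', inv_mul_cancel₀ hQ0.ne']
    simp
  simp only [hpt] at key
  rwa [lintegral_prod (fun z : 𝔼 × 𝔼 => F z.1 * K (z.1 - z.2) * h z.2) ((hF.comp_fst.mul
    (hK.comp (measurable_fst.sub measurable_snd)).aemeasurable).mul hh.comp_snd)] at key

/-! ### The truncated Riesz kernel. -/

/-- Scaling of Lebesgue norms under dilation. -/
theorem lintegral_rpow_comp_smul {K : 𝔼 → ℝ≥0∞} (hK : Measurable K) {R γ B : ℝ} (hR : 0 < R)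
    (hB : 0 < B) :
    (∫⁻ x, (ENNReal.ofReal (R ^ γ) * K (R⁻¹ • x)) ^ B⁻¹) ^ B =
      ENNReal.ofReal (R ^ (γ + d * B)) * (∫⁻ x, K x ^ B⁻¹) ^ B := by
  have hB' : 0 ≤ B⁻¹ := by positivity
  have hmap := Measure.map_addHaar_smul (volume : Measure 𝔼) (inv_pos.2 hR).ne'
  have h1 : ∫⁻ x, K (R⁻¹ • x) ^ B⁻¹ = ENNReal.ofReal (R ^ d) * ∫⁻ x, K x ^ B⁻¹ := by
    have h2 := lintegral_map (μ := (volume : Measure 𝔼)) (hK.pow_const B⁻¹)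
      (measurable_const_smul (R⁻¹ : ℝ))
    rw [← h2, hmap, lintegral_smul_measure]
    simp [abs_of_pos hR]
  have hKR : Measurable fun x => K (R⁻¹ • x) := hK.comp (measurable_const_smul (R⁻¹ : ℝ))
  simp only [ENNReal.mul_rpow_of_nonneg _ _ hB']
  rw [lintegral_const_mul _ (hKR.pow_const _), h1,
    ENNReal.mul_rpow_of_nonneg _ _ hB.le, ENNReal.mul_rpow_of_nonneg _ _ hB.le,
    ← ENNReal.rpow_mul, inv_mul_cancel₀ hB.ne', ENNReal.rpow_one, ← mul_assoc,
    ENNReal.ofReal_rpow_of_pos (by positivity), ← ENNReal.ofReal_mul (by positivity),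
    ← Real.rpow_natCast, ← Real.rpow_mul hR.le, ← Real.rpow_add hR]

/-- The singular part of the Riesz kernel is in `L^b` below the critical exponent. -/
theorem lintegral_rpow_near_lt_top (hd : 3 ≤ d) {γ B : ℝ} (hB : 0 < B) (h : 0 < γ + d * B) :
    ∫⁻ x : 𝔼, ((Metric.ball 0 1).indicator (fun x => ENNReal.ofReal (‖x‖ ^ γ)) x) ^ B⁻¹ < ⊤ := by
  have hint : IntegrableOn (fun x : 𝔼 => ‖x‖ ^ (γ * B⁻¹)) (Metric.ball 0 1) volume := by
    refine integrableOn_ball_of_norm_le_rpow (C := 1) (α := -(γ * B⁻¹)) (by simp; omega) ?_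
      (ae_of_all _ fun x => ?_) ?_
    · rw [finrank_euclideanSpace_fin, ← div_eq_mul_inv, ← neg_div, div_lt_iff₀ hB]
      linarith
    · rw [neg_neg, one_mul, Real.norm_of_nonneg (by positivity)]
    · exact (measurable_norm.pow_const _).aestronglyMeasurable
  have h2 := hint.2
  rw [HasFiniteIntegral] at h2
  refine lt_of_eq_of_lt ?_ h2
  rw [← lintegral_indicator Metric.isOpen_ball.measurableSet]
  refine lintegral_congr fun x => ?_
  by_cases hx : x ∈ Metric.ball (0 : 𝔼) 1
  · simp only [Set.indicator_of_mem hx]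
    rw [ENNReal.ofReal_rpow_of_nonneg (by positivity) (by positivity),
      ← Real.rpow_mul (norm_nonneg _), Real.enorm_of_nonneg (by positivity)]
  · simp [Set.indicator_of_notMem hx, hB]

/-- The tail of the Riesz kernel is in `L^b` above the critical exponent. -/
theorem lintegral_rpow_far_lt_top {γ B : ℝ} (hγ : γ ≤ 0) (hB : 0 < B)
    (h : γ + d * B < 0) :
    ∫⁻ x : 𝔼, ((Metric.ball 0 1)ᶜ.indicator (fun x => ENNReal.ofReal (‖x‖ ^ γ)) x) ^ B⁻¹ < ⊤ := by
  have hint := integrable_one_add_norm (E := 𝔼) (μ := volume) (r := -(γ * B⁻¹)) (by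
    rw [finrank_euclideanSpace_fin, ← div_eq_mul_inv, ← neg_div, lt_div_iff₀ hB]
    linarith)
  -- The factor comes from `1 + ‖x‖ ≤ 2‖x‖` outside the unit ball.
  have h2 := (hint.const_mul (2 ^ (-(γ * B⁻¹)))).2
  rw [HasFiniteIntegral] at h2
  refine lt_of_le_of_lt (lintegral_mono fun x => ?_) h2
  by_cases hx : x ∈ (Metric.ball (0 : 𝔼) 1)ᶜ
  · simp only [Set.indicator_of_mem hx]
    have hx1 : 1 ≤ ‖x‖ := by simpa using hx
    rw [ENNReal.ofReal_rpow_of_nonneg (by positivity) (by positivity),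
      ← Real.rpow_mul (norm_nonneg _), Real.enorm_of_nonneg (by positivity)]
    refine ENNReal.ofReal_le_ofReal ?_
    rw [neg_neg, Real.rpow_neg (by norm_num), ← Real.inv_rpow (by norm_num),
      ← Real.mul_rpow (by norm_num) (by positivity)]
    refine Real.rpow_le_rpow_of_nonpos (by positivity) (by linarith) ?_
    exact mul_nonpos_of_nonpos_of_nonneg hγ (by positivity)
  · simp [Set.indicator_of_notMem hx, hB]

/-! ### The unweighted form at a length scale `R`, and the choice of `R`. -/

/-- Interpolated Sobolev inequality for `u²`; `P` is the inverse Lebesgue exponent. -/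
theorem exists_lintegral_sq_rpow_le (hd : 3 ≤ d) :
    ∃ S : ℝ, 0 < S ∧ ∀ (u : 𝔼 → ℝ) (G : 𝔼 → 𝔼), IsH1WithGradient u G →
      ∀ θ P : ℝ, 0 ≤ θ → θ ≤ 1 → P = 1 - 2 * θ / d →
      (∫⁻ x, (‖u x‖ₑ ^ 2) ^ P⁻¹) ^ P ≤
        (∫⁻ x, ‖u x‖ₑ ^ 2) ^ (1 - θ) * (ENNReal.ofReal S * ∫⁻ x, ‖G x‖ₑ ^ 2) ^ θ := by
  have hd3 : (3 : ℝ) ≤ d := by exact_mod_cast hd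
  have hd2 : (0 : ℝ) < d - 2 := by linarith
  have hd0 : (0 : ℝ) < d := by linarith
  set c := eLpNormLESNormFDerivOfEqInnerConst (volume : Measure 𝔼) 2
  refine ⟨c ^ 2 + 1, by positivity, fun u G h θ P hθ0 hθ1 hP => ?_⟩
  -- Half the Sobolev exponent: the `L^m` norm of `u²` is the square of the `L^{2m}` norm of `u`.
  set m : ℝ := d / (d - 2)
  have hm : 0 < m := by positivity
  have hP0 : 0 < P := by
    rw [hP, sub_pos, div_lt_one hd0]
    linarith
  refine (lintegral_rpow_interpolation (h.1.1.enorm.pow_const 2) hm hθ0 hθ1 hP0 ?_).trans ?_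
  · rw [hP]
    simp only [m]
    field_simp
    ring
  gcongr
  have h2m : 0 ≤ 2 * m := by positivity
  obtain ⟨p', hp'⟩ : ∃ p' : ℝ≥0, (p' : ℝ) = 2 * m := ⟨(2 * m).toNNReal, Real.coe_toNNReal _ h2m⟩
  have hp0 : p' ≠ 0 := by
    rintro rfl
    rw [NNReal.coe_zero] at hp'
    linarith
  have hs := h.eLpNorm_le hd (p' := p') (by
    rw [hp']
    simp only [m]
    field_simp)
  rw [eLpNorm_eq_lintegral_rpow_enorm_toReal (by exact_mod_cast hp0) ENNReal.coe_ne_top,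
    eLpNorm_eq_lintegral_rpow_enorm_toReal (by norm_num) (by norm_num)] at hs
  simp only [ENNReal.coe_toReal, hp', ENNReal.toReal_ofNat, ENNReal.rpow_ofNat] at hs
  have hs2 := pow_le_pow_left' hs 2
  rw [mul_pow, ← ENNReal.rpow_natCast, ← ENNReal.rpow_mul, ← ENNReal.rpow_natCast (_ ^ _),
    ← ENNReal.rpow_mul] at hs2
  have e1 : 1 / (2 * m) * ((2 : ℕ) : ℝ) = m⁻¹ := by push_cast; field_simp
  have e2 : 1 / (2 : ℝ) * ((2 : ℕ) : ℝ) = 1 := by norm_num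
  have e3 (x : 𝔼) : (‖u x‖ₑ ^ 2) ^ m = ‖u x‖ₑ ^ (2 * m) := by
    rw [← ENNReal.rpow_ofNat, ← ENNReal.rpow_mul]
  rw [e1, e2, ENNReal.rpow_one] at hs2
  simp only [e3]
  refine hs2.trans ?_
  gcongr
  rw [← ENNReal.ofReal_coe_nnreal, ← ENNReal.ofReal_pow (by positivity)]
  exact ENNReal.ofReal_le_ofReal (by linarith)

/-- Weighted geometric means are controlled by sums. -/
theorem rpow_mul_rpow_le_scaled_add {θ s R : ℝ} (hθ0 : 0 ≤ θ) (hθ1 : θ ≤ 1) (hR : 0 < R)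
    (X Z : ℝ≥0∞) :
    ENNReal.ofReal (R ^ (2 * θ - 2 * s)) * (X ^ (1 - θ) * Z ^ θ) ≤
      ENNReal.ofReal (R ^ (-(2 * s))) * (X + ENNReal.ofReal (R ^ 2) * Z) := by
  have h1 : ENNReal.ofReal (R ^ (2 * θ - 2 * s)) =
      ENNReal.ofReal (R ^ (-(2 * s))) * ENNReal.ofReal (R ^ 2) ^ θ := by
    rw [ENNReal.ofReal_rpow_of_pos (by positivity), ← ENNReal.ofReal_mul (by positivity),
      ← Real.rpow_natCast, ← Real.rpow_mul hR.le, ← Real.rpow_add hR]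
    congr 2
    push_cast
    ring
  -- Both entries of the geometric mean are at most `T`. The resulting bound no longer depends on
  -- `θ`, so contributions with different `θ` can be added.
  set T := X + ENNReal.ofReal (R ^ 2) * Z
  calc ENNReal.ofReal (R ^ (2 * θ - 2 * s)) * (X ^ (1 - θ) * Z ^ θ)
      = ENNReal.ofReal (R ^ (-(2 * s))) * (X ^ (1 - θ) * (ENNReal.ofReal (R ^ 2) * Z) ^ θ) := by
        rw [h1, ENNReal.mul_rpow_of_nonneg _ _ hθ0]
        ring
    _ ≤ ENNReal.ofReal (R ^ (-(2 * s))) * (T ^ (1 - θ) * T ^ θ) := by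
        have h1θ : 0 ≤ 1 - θ := by linarith
        gcongr
        · exact le_self_add
        · exact le_add_self
    _ = _ := by
        rw [← ENNReal.rpow_add_of_nonneg _ _ (by linarith) hθ0]
        simp

/-- Optimization over the scale `R`. -/
theorem le_of_forall_scale {s : ℝ} (hs0 : 0 < s) (hs1 : s < 1) {κ S T H X Y : ℝ} (hκ : 0 < κ) (hS : 0 < S)
    (hH : 0 ≤ H) (hY : 0 ≤ Y)
    (hT : ∀ R : ℝ, 0 < R → T ≤ κ * H * (R ^ (-(2 * s)) * (X + R ^ 2 * (S * Y))))
    {ε : ℝ} (hε : 0 < ε) :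
    T ≤ ε * Y + κ * (κ * S) ^ (s / (1 - s)) *
      (ε ^ (-(s / (1 - s))) * H ^ (1 / (1 - s))) * X := by
  have h1s : 0 < 1 - s := by linarith
  rcases hH.eq_or_lt with rfl | hH
  · have h1 := hT 1 one_pos
    have h2 : T ≤ 0 := by simpa using h1
    rw [Real.zero_rpow (by positivity)]
    simpa using h2.trans (mul_nonneg hε.le hY)
  · set δ := ε / (κ * S)
    have hδ : 0 < δ := by positivity
    -- `R` solves `H R^{2-2s} = δ`, and `δ` is such that the gradient term `κ δ S Y` is exactly `ε
    -- Y`.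
    set R := (δ / H) ^ (1 / (2 * (1 - s)))
    have hR : 0 < R := by positivity
    have e1 : H * R ^ (-(2 * s)) = δ ^ (-(s / (1 - s))) * H ^ (1 / (1 - s)) := by
      simp only [R]
      rw [← Real.rpow_mul (by positivity), Real.div_rpow hδ.le hH.le]
      have : 1 / (2 * (1 - s)) * -(2 * s) = -(s / (1 - s)) := by field_simp
      rw [this, div_eq_mul_inv, ← Real.rpow_neg hH.le, neg_neg]
      have h3 : H ^ (1 / (1 - s)) = H * H ^ (s / (1 - s)) := by
        nth_rw 2 [← Real.rpow_one H]
        rw [← Real.rpow_add hH]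
        congr 1
        field_simp
        ring
      rw [h3]
      ring
    have e2 : H * R ^ (-(2 * s)) * R ^ 2 = δ := by
      rw [mul_assoc, ← Real.rpow_natCast, ← Real.rpow_add hR]
      simp only [R]
      rw [← Real.rpow_mul (by positivity)]
      have : 1 / (2 * (1 - s)) * (-(2 * s) + ((2 : ℕ) : ℝ)) = 1 := by push_cast; field_simp; ring
      rw [this, Real.rpow_one]
      field_simp
    have e3 : δ ^ (-(s / (1 - s))) = (κ * S) ^ (s / (1 - s)) * ε ^ (-(s / (1 - s))) := by
      simp only [δ]
      rw [Real.div_rpow hε.le (by positivity), Real.rpow_neg (x := κ * S) (by positivity)]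
      field_simp
    calc T ≤ κ * H * (R ^ (-(2 * s)) * (X + R ^ 2 * (S * Y))) := hT R hR
      _ = κ * (H * R ^ (-(2 * s))) * X + κ * (H * R ^ (-(2 * s)) * R ^ 2) * S * Y := by ring
      _ = κ * (δ ^ (-(s / (1 - s))) * H ^ (1 / (1 - s))) * X + ε * Y := by
        rw [e2, e1]
        simp only [δ]
        field_simp
      _ = _ := by rw [e3]; ring

/-- Bound for the Riesz potential form at every length scale `R`. -/
theorem exists_riesz_form_le (hd : 3 ≤ d) {γ q s : ℝ} (hγd : -(d : ℝ) < γ) (hγ0 : γ < 0)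
    (hq : 1 ≤ q) (hs : s = ((d : ℝ) - q * (d + γ)) / (2 * q)) (hs0 : 0 < s) (hs1 : s < 1) :
    ∃ κ S : ℝ, 0 < κ ∧ 0 < S ∧ ∀ (u : 𝔼 → ℝ) (G : 𝔼 → 𝔼) (h : 𝔼 → ℝ≥0∞),
      IsH1WithGradient u G → AEMeasurable h volume → ∀ R : ℝ, 0 < R →
      ∫⁻ x, ∫⁻ y, ‖u x‖ₑ ^ 2 * ENNReal.ofReal (‖x - y‖ ^ γ) * h y ≤
        ENNReal.ofReal κ * (∫⁻ y, h y ^ q) ^ (1 / q) * (ENNReal.ofReal (R ^ (-(2 * s))) *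
          ((∫⁻ x, ‖u x‖ₑ ^ 2) + ENNReal.ofReal (R ^ 2) *
            (ENNReal.ofReal S * ∫⁻ x, ‖G x‖ₑ ^ 2))) := by
  have hd3 : (3 : ℝ) ≤ d := by exact_mod_cast hd
  have hd0 : (0 : ℝ) < d := by linarith
  have hq0 : 0 < q := by linarith
  obtain ⟨S, hS, hsob⟩ := exists_lintegral_sq_rpow_le hd
  -- The bound 1 is the limit of the Sobolev interpolation; `d / (2q)` keeps the kernel's Lebesgue
  -- exponent at least 1, and it exceeds `s` because `γ + d > 0`.
  set θ₁ : ℝ := min 1 (d / (2 * q))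
  have hsd : 2 * s = d / q - d - γ := by rw [hs]; field_simp; ring
  have hθ₁s : s < θ₁ := by
    refine lt_min hs1 ?_
    have : d / (2 * q) = d / q / 2 := by field_simp
    rw [this]
    linarith
  have hθ₁1 : θ₁ ≤ 1 := min_le_left _ _
  have hθ₁q : θ₁ ≤ d / (2 * q) := min_le_right _ _
  -- The inverse kernel exponent forced by Young: `(1 - 2θ/d) + b θ + 1/q = 2`.
  let b : ℝ → ℝ := fun θ => 1 - 1 / q + 2 * θ / d
  have hq1 : 1 / q ≤ 1 := by rw [div_le_one hq0]; exact hq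
  have hb0 (θ : ℝ) (hθ : 0 < θ) : 0 < b θ := by
    have : 0 < 2 * θ / d := by positivity
    simp only [b]; linarith
  have hb1 (θ : ℝ) (hθ : θ ≤ θ₁) : b θ ≤ 1 := by
    have h1 : 2 * θ / d ≤ 1 / q := by
      rw [div_le_iff₀ hd0]
      have : d / (2 * q) = 1 / q * d / 2 := by field_simp
      rw [this] at hθ₁q
      linarith
    simp only [b]; linarith
  -- The sign of this quantity decides which half of the kernel has a finite norm: near the origin
  -- for `θ > s`, at infinity for `θ < s`.
  have hscale (θ : ℝ) : γ + d * b θ = 2 * θ - 2 * s := by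
    rw [hsd]; simp only [b]; field_simp; ring
  let near : 𝔼 → ℝ≥0∞ := (Metric.ball 0 1).indicator fun x => ENNReal.ofReal (‖x‖ ^ γ)
  let far : 𝔼 → ℝ≥0∞ := (Metric.ball 0 1)ᶜ.indicator fun x => ENNReal.ofReal (‖x‖ ^ γ)
  have hkm : Measurable fun x : 𝔼 => ENNReal.ofReal (‖x‖ ^ γ) :=
    (measurable_norm.pow_const _).ennreal_ofReal
  have hnm : Measurable near := hkm.indicator Metric.isOpen_ball.measurableSet
  have hfm : Measurable far := hkm.indicator Metric.isOpen_ball.measurableSet.compl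
  have hs2 : 0 < s / 2 := by positivity
  set k₁ := (∫⁻ x, near x ^ (b θ₁)⁻¹) ^ (b θ₁)
  set k₂ := (∫⁻ x, far x ^ (b (s / 2))⁻¹) ^ (b (s / 2))
  have hk₁ : k₁ ≠ ⊤ := ENNReal.rpow_ne_top_of_nonneg (hb0 θ₁ (hs0.trans hθ₁s)).le
    (lintegral_rpow_near_lt_top hd (hb0 θ₁ (hs0.trans hθ₁s)) (by rw [hscale]; linarith)).ne
  have hk₂ : k₂ ≠ ⊤ := ENNReal.rpow_ne_top_of_nonneg (hb0 _ hs2).le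
    (lintegral_rpow_far_lt_top hγ0.le (hb0 _ hs2) (by rw [hscale]; linarith)).ne
  refine ⟨k₁.toReal + k₂.toReal + 1, S, by positivity, hS, fun u G h hu hh R hR => ?_⟩
  set X := ∫⁻ x, ‖u x‖ₑ ^ 2
  set Z := ENNReal.ofReal S * ∫⁻ x, ‖G x‖ₑ ^ 2
  set H := (∫⁻ y, h y ^ q) ^ (1 / q)
  have hF : AEMeasurable (fun x => ‖u x‖ₑ ^ 2) volume := hu.1.1.enorm.pow_const 2
  have bound (K : 𝔼 → ℝ≥0∞) (hK : Measurable K) (θ : ℝ) (hθ0 : 0 < θ) (hθ1 : θ ≤ θ₁) :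
      ∫⁻ x, ∫⁻ y, ‖u x‖ₑ ^ 2 * (ENNReal.ofReal (R ^ γ) * K (R⁻¹ • (x - y))) * h y ≤
        (∫⁻ x, K x ^ (b θ)⁻¹) ^ (b θ) * H * (ENNReal.ofReal (R ^ (-(2 * s))) *
          (X + ENNReal.ofReal (R ^ 2) * Z)) := by
    have hP0 : 0 < 1 - 2 * θ / d := by
      rw [sub_pos, div_lt_one hd0]; linarith
    have hP1 : 1 - 2 * θ / d ≤ 1 := by
      have : 0 < 2 * θ / d := by positivity
      linarith
    have hy := lintegral_lintegral_mul_conv_le hF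
      (K := fun x => ENNReal.ofReal (R ^ γ) * K (R⁻¹ • x))
      ((hK.comp (measurable_const_smul (R⁻¹ : ℝ))).const_mul _) hh
      (P := 1 - 2 * θ / d) (B := b θ) (Q := 1 / q) hP0 hP1 (hb0 θ hθ0) (hb1 θ hθ1)
      (by positivity) hq1 (by simp only [b]; ring)
    refine hy.trans ?_
    rw [lintegral_rpow_comp_smul hK hR (hb0 θ hθ0), hscale, one_div, inv_inv]
    have h1 := hsob u G hu θ _ hθ0.le (hθ1.trans hθ₁1) rfl
    calc (∫⁻ x, (‖u x‖ₑ ^ 2) ^ (1 - 2 * θ / d)⁻¹) ^ (1 - 2 * θ / d) *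
          (ENNReal.ofReal (R ^ (2 * θ - 2 * s)) * (∫⁻ x, K x ^ (b θ)⁻¹) ^ b θ) *
          (∫⁻ x, h x ^ q) ^ q⁻¹
        ≤ (X ^ (1 - θ) * Z ^ θ) *
          (ENNReal.ofReal (R ^ (2 * θ - 2 * s)) * (∫⁻ x, K x ^ (b θ)⁻¹) ^ b θ) * H := by
          simp only [H, one_div]
          gcongr
      _ = (∫⁻ x, K x ^ (b θ)⁻¹) ^ (b θ) * H *
          (ENNReal.ofReal (R ^ (2 * θ - 2 * s)) * (X ^ (1 - θ) * Z ^ θ)) := by ring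
      _ ≤ _ := by
          refine mul_le_mul_right ?_ _
          exact rpow_mul_rpow_le_scaled_add hθ0.le (hθ1.trans hθ₁1) hR X Z
  -- By homogeneity, cutting the kernel at radius `R` is the dilation of cutting it at radius 1.
  have hsplit (z : 𝔼) : ENNReal.ofReal (‖z‖ ^ γ) =
      ENNReal.ofReal (R ^ γ) * near (R⁻¹ • z) + ENNReal.ofReal (R ^ γ) * far (R⁻¹ • z) := by
    rw [← mul_add]
    simp only [near, far]
    rw [← Pi.add_apply, Set.indicator_self_add_compl, ← ENNReal.ofReal_mul (by positivity),
      norm_smul, Real.norm_of_nonneg (by positivity),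
      Real.mul_rpow (by positivity) (by positivity), Real.inv_rpow hR.le]
    congr 1
    have : 0 < R ^ γ := by positivity
    field_simp
  have hmeas (K : 𝔼 → ℝ≥0∞) (hK : Measurable K) : AEMeasurable (fun z : 𝔼 × 𝔼 =>
      ‖u z.1‖ₑ ^ 2 * (ENNReal.ofReal (R ^ γ) * K (R⁻¹ • (z.1 - z.2))) * h z.2)
      (volume.prod volume) := by
    refine (hF.comp_fst.mul (Measurable.aemeasurable ?_)).mul hh.comp_snd
    exact (hK.comp ((measurable_fst.sub measurable_snd).const_smul (R⁻¹ : ℝ))).const_mul _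
  calc ∫⁻ x, ∫⁻ y, ‖u x‖ₑ ^ 2 * ENNReal.ofReal (‖x - y‖ ^ γ) * h y
      ≤ (∫⁻ x, ∫⁻ y, ‖u x‖ₑ ^ 2 * (ENNReal.ofReal (R ^ γ) * near (R⁻¹ • (x - y))) * h y) +
        ∫⁻ x, ∫⁻ y, ‖u x‖ₑ ^ 2 * (ENNReal.ofReal (R ^ γ) * far (R⁻¹ • (x - y))) * h y := by
        rw [← lintegral_prod _ (hmeas near hnm), ← lintegral_prod _ (hmeas far hfm),
          ← lintegral_add_left' (hmeas near hnm),
          lintegral_prod (fun z : 𝔼 × 𝔼 => _ + _) ((hmeas near hnm).add (hmeas far hfm))]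
        refine le_of_eq (lintegral_congr fun x => lintegral_congr fun y => ?_)
        simp only [hsplit]
        ring
    _ ≤ k₁ * H * (ENNReal.ofReal (R ^ (-(2 * s))) * (X + ENNReal.ofReal (R ^ 2) * Z)) +
        k₂ * H * (ENNReal.ofReal (R ^ (-(2 * s))) * (X + ENNReal.ofReal (R ^ 2) * Z)) :=
        add_le_add (bound near hnm θ₁ (hs0.trans hθ₁s) le_rfl)
          (bound far hfm (s / 2) hs2 (by linarith))
    _ = (k₁ + k₂) * H * (ENNReal.ofReal (R ^ (-(2 * s))) *
        (X + ENNReal.ofReal (R ^ 2) * Z)) := by ring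
    _ ≤ _ := by
        gcongr
        rw [ENNReal.ofReal_add (by positivity) zero_le_one,
          ENNReal.ofReal_add (by positivity) (by positivity), ENNReal.ofReal_toReal hk₁,
          ENNReal.ofReal_toReal hk₂]
        exact le_self_add

/-! ### The weights. -/

theorem bracket_pos (v : 𝔼) : 0 < bracket v := Real.sqrt_pos.2 (by positivity)

theorem measurable_bracket : Measurable (bracket : 𝔼 → ℝ) :=
  ((measurable_norm.pow_const 2).const_add 1).sqrt

/-- `⟨v⟩` is the Euclidean norm of `(1, v)`, hence 1-Lipschitz. -/
theorem bracket_le_bracket_add (v w : 𝔼) : bracket v ≤ bracket w + ‖v - w‖ := by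
  have hw : ‖w‖ ≤ bracket w := Real.le_sqrt_of_sq_le (by linarith)
  have hw2 : bracket w ^ 2 = 1 + ‖w‖ ^ 2 := Real.sq_sqrt (by positivity)
  have hv : ‖v‖ ≤ ‖w‖ + ‖v - w‖ := by
    simpa using norm_add_le w (v - w)
  refine Real.sqrt_le_iff.2 ⟨add_nonneg (bracket_pos w).le (norm_nonneg _), ?_⟩
  nlinarith [norm_nonneg (v - w), norm_nonneg v, norm_nonneg w]

/-- Away from the diagonal the kernel absorbs the weight `⟨v⟩^{-γ}`; near the diagonal the
weight can be moved to `w`. -/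
theorem bracket_rpow_mul_norm_sub_rpow_le {γ : ℝ} (hγ : γ < 0) (v w : 𝔼) :
    bracket v ^ (-γ) * ‖v - w‖ ^ γ ≤ 2 ^ (-γ) * (1 + ‖v - w‖ ^ γ * bracket w ^ (-γ)) := by
  have hv := bracket_pos v
  have hw := bracket_pos w
  have hk : 0 ≤ ‖v - w‖ ^ γ := by positivity
  have hγ' : 0 ≤ -γ := by linarith
  rcases le_or_gt (bracket v / 2) ‖v - w‖ with h | h
  · have h1 : ‖v - w‖ ^ γ ≤ (bracket v / 2) ^ γ :=
      Real.rpow_le_rpow_of_nonpos (by positivity) h hγ.le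
    have h2 : bracket v ^ (-γ) * (bracket v / 2) ^ γ = 2 ^ (-γ) := by
      rw [Real.div_rpow hv.le (by norm_num), Real.rpow_neg hv.le, Real.rpow_neg (by norm_num)]
      have : 0 < bracket v ^ γ := by positivity
      field_simp
    calc bracket v ^ (-γ) * ‖v - w‖ ^ γ ≤ 2 ^ (-γ) * 1 := by
          rw [mul_one, ← h2]; gcongr
      _ ≤ _ := by
          gcongr
          have : 0 ≤ ‖v - w‖ ^ γ * bracket w ^ (-γ) := by positivity
          linarith
  · have h1 : bracket v ≤ 2 * bracket w := by
      have := bracket_le_bracket_add v w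
      linarith
    calc bracket v ^ (-γ) * ‖v - w‖ ^ γ ≤ (2 * bracket w) ^ (-γ) * ‖v - w‖ ^ γ := by gcongr
      _ = 2 ^ (-γ) * (‖v - w‖ ^ γ * bracket w ^ (-γ)) := by
          rw [Real.mul_rpow (by norm_num) hw.le]; ring
      _ ≤ _ := by gcongr; linarith

theorem enorm_sq_eq_bracket_mul (γ : ℝ) (φ : 𝔼 → ℝ) (v : 𝔼) :
    ‖φ v‖ₑ ^ 2 = ENNReal.ofReal (bracket v ^ (-γ)) * ‖bracket v ^ (γ / 2) * φ v‖ₑ ^ 2 := by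
  have hv := bracket_pos v
  have h1 : ‖bracket v ^ (γ / 2)‖ₑ = ENNReal.ofReal (bracket v ^ (γ / 2)) :=
    Real.enorm_of_nonneg (by positivity)
  rw [enorm_mul, mul_pow, ← mul_assoc, h1,
    ← ENNReal.ofReal_pow (by positivity), ← ENNReal.ofReal_mul (by positivity),
    ← Real.rpow_natCast, ← Real.rpow_mul hv.le, ← Real.rpow_add hv]
  norm_num

/-- The Sobolev hypothesis concerns only the weighted function; dividing by the positive weight
recovers `φ`. -/
theorem aestronglyMeasurable_of_bracket_mul {γ : ℝ} {φ : 𝔼 → ℝ}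
    (h : AEStronglyMeasurable (fun v => bracket v ^ γ * φ v) volume) :
    AEStronglyMeasurable φ volume := by
  have h1 := (measurable_bracket.pow_const (-γ)).aestronglyMeasurable.mul h
  refine h1.congr (ae_of_all _ fun v => ?_)
  have hv := bracket_pos v
  simp only [Pi.mul_apply]
  rw [← mul_assoc, ← Real.rpow_add hv]
  simp

theorem lintegral_enorm_sq_eq {F : Type*} [NormedAddCommGroup F] {f : 𝔼 → F}
    (hf : MemLp f 2 volume) : ∫⁻ v, ‖f v‖ₑ ^ 2 = ENNReal.ofReal (∫ v, ‖f v‖ ^ 2) := by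
  rw [ofReal_integral_eq_lintegral_ofReal (hf.integrable_norm_pow (by norm_num))
    (ae_of_all _ fun v => by positivity)]
  refine lintegral_congr fun v => ?_
  rw [ENNReal.ofReal_pow (norm_nonneg _), ofReal_norm]

theorem integral_norm_sq_bracket_mul (γ : ℝ) (φ : 𝔼 → ℝ) :
    ∫ v, ‖bracket v ^ (γ / 2) * φ v‖ ^ 2 = ∫ v, φ v ^ 2 * bracket v ^ γ := by
  refine integral_congr_ae (ae_of_all _ fun v => ?_)
  have hv := bracket_pos v
  simp only [Real.norm_eq_abs, sq_abs]
  rw [mul_pow, ← Real.rpow_natCast (bracket v ^ _), ← Real.rpow_mul hv.le, mul_comm]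
  norm_num

theorem weightedLpNorm_nonneg (p k : ℝ) (f : 𝔼 → ℝ) : 0 ≤ weightedLpNorm p k f :=
  Real.rpow_nonneg (integral_nonneg fun v =>
    mul_nonneg (by positivity) (Real.rpow_nonneg (bracket_pos v).le _)) _

/-- The weight `⟨w⟩^{qk}` is the `q`-th power of `⟨w⟩^k`, so the weighted norm becomes a plain `L^q`
norm, the form in which Hölder and Young use it. -/
theorem lintegral_weighted_rpow_eq {q k : ℝ} (hq : 0 < q) {g : 𝔼 → ℝ}
    (hg : MemWeightedLp q (q * k) g) :
    (∫⁻ w, (ENNReal.ofReal (bracket w ^ k) * ‖g w‖ₑ) ^ q) ^ (1 / q) =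
      ENNReal.ofReal (weightedLpNorm q (q * k) g) := by
  have hnn (v : 𝔼) : 0 ≤ |g v| ^ q * bracket v ^ (q * k) :=
    mul_nonneg (by positivity) (Real.rpow_nonneg (bracket_pos v).le _)
  rw [weightedLpNorm, ← ENNReal.ofReal_rpow_of_nonneg (integral_nonneg hnn) (by positivity),
    ofReal_integral_eq_lintegral_ofReal hg.2 (ae_of_all _ hnn)]
  congr 1
  refine lintegral_congr fun w => ?_
  have hw := bracket_pos w
  rw [← ofReal_norm, ← ENNReal.ofReal_mul (by positivity),
    ENNReal.ofReal_rpow_of_nonneg (by positivity) hq.le,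
    Real.mul_rpow (by positivity) (by positivity), ← Real.rpow_mul hw.le, Real.norm_eq_abs,
    mul_comm k q, mul_comm]

/-! ### The estimates for `c_γ`. -/

/-- The Riesz potential of an integrable function converges almost everywhere. -/
theorem ae_integrable_riesz (hd : 3 ≤ d) {γ : ℝ} (hγd : -(d : ℝ) < γ) (hγ0 : γ < 0) {g : 𝔼 → ℝ}
    (hg : Integrable g volume) : ∀ᵐ v : 𝔼, Integrable (fun w => ‖v - w‖ ^ γ * g w) volume := by
  -- The singular part is in `L¹`, so its convolution with `g` exists almost everywhere; elsewhere
  -- the kernel is at most 1.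
  set k : 𝔼 → ℝ := (Metric.ball 0 1).indicator fun x => ‖x‖ ^ γ
  have hk : Integrable k volume := by
    rw [integrable_indicator_iff Metric.isOpen_ball.measurableSet]
    refine integrableOn_ball_of_norm_le_rpow (C := 1) (α := -γ) (by simp; omega)
      (by simp; linarith) (ae_of_all _ fun x => ?_)
      (measurable_norm.pow_const _).aestronglyMeasurable
    rw [neg_neg, one_mul, Real.norm_of_nonneg (by positivity)]
  filter_upwards [hg.ae_convolution_exists (ContinuousLinearMap.mul ℝ ℝ) hk] with v hv
  have hv' : Integrable (fun w => g w * k (v - w)) volume := hv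
  refine (hv'.norm.add hg.norm).mono' ?_ (ae_of_all _ fun w => ?_)
  · exact ((measurable_const.sub measurable_id).norm.pow_const γ).aestronglyMeasurable.mul hg.1
  · simp only [Pi.add_apply, norm_mul]
    rw [Real.norm_of_nonneg (by positivity : 0 ≤ ‖v - w‖ ^ γ)]
    by_cases h : v - w ∈ Metric.ball (0 : 𝔼) 1
    · simp only [k, Set.indicator_of_mem h]
      rw [Real.norm_of_nonneg (by positivity : 0 ≤ ‖v - w‖ ^ γ), mul_comm]
      linarith [norm_nonneg (g w)]
    · have h1 : 1 ≤ ‖v - w‖ := by simpa using h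
      have h2 : ‖v - w‖ ^ γ ≤ 1 := Real.rpow_le_one_of_one_le_of_nonpos h1 hγ0.le
      have h3 := mul_le_of_le_one_left (norm_nonneg (g w)) h2
      have h4 : 0 ≤ ‖g w‖ * ‖k (v - w)‖ := by positivity
      linarith

/-- The quadratic form with weights, reduced to the unweighted Riesz form. -/
theorem weighted_riesz_form_le {γ : ℝ} (hγ0 : γ < 0) {φ g : 𝔼 → ℝ}
    (hφ : AEStronglyMeasurable (fun v => bracket v ^ (γ / 2) * φ v) volume)
    (hg : AEStronglyMeasurable g volume) :
    ∫⁻ v, ∫⁻ w, ‖φ v‖ₑ ^ 2 * ENNReal.ofReal (‖v - w‖ ^ γ) * ‖g w‖ₑ ≤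
      ENNReal.ofReal (2 ^ (-γ)) *
        ((∫⁻ v, ‖bracket v ^ (γ / 2) * φ v‖ₑ ^ 2) * (∫⁻ w, ‖g w‖ₑ) +
        ∫⁻ v, ∫⁻ w, ‖bracket v ^ (γ / 2) * φ v‖ₑ ^ 2 * ENNReal.ofReal (‖v - w‖ ^ γ) *
          (ENNReal.ofReal (bracket w ^ (-γ)) * ‖g w‖ₑ)) := by
  set u : 𝔼 → ℝ := fun v => bracket v ^ (γ / 2) * φ v
  have hu : AEMeasurable (fun v => ‖u v‖ₑ ^ 2) volume := hφ.enorm.pow_const 2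
  have hpt (v w : 𝔼) : ‖φ v‖ₑ ^ 2 * ENNReal.ofReal (‖v - w‖ ^ γ) * ‖g w‖ₑ ≤
      ENNReal.ofReal (2 ^ (-γ)) * (‖u v‖ₑ ^ 2 * ‖g w‖ₑ +
        ‖u v‖ₑ ^ 2 * ENNReal.ofReal (‖v - w‖ ^ γ) *
          (ENNReal.ofReal (bracket w ^ (-γ)) * ‖g w‖ₑ)) := by
    have hv := bracket_pos v
    have hw := bracket_pos w
    have h1 : ENNReal.ofReal (bracket v ^ (-γ)) * ENNReal.ofReal (‖v - w‖ ^ γ) ≤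
        ENNReal.ofReal (2 ^ (-γ)) *
          (1 + ENNReal.ofReal (‖v - w‖ ^ γ) * ENNReal.ofReal (bracket w ^ (-γ))) := by
      rw [← ENNReal.ofReal_mul (by positivity), ← ENNReal.ofReal_mul (by positivity),
        ← ENNReal.ofReal_one, ← ENNReal.ofReal_add (by norm_num) (by positivity),
        ← ENNReal.ofReal_mul (by positivity)]
      exact ENNReal.ofReal_le_ofReal (bracket_rpow_mul_norm_sub_rpow_le hγ0 v w)
    calc ‖φ v‖ₑ ^ 2 * ENNReal.ofReal (‖v - w‖ ^ γ) * ‖g w‖ₑ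
        = (ENNReal.ofReal (bracket v ^ (-γ)) * ENNReal.ofReal (‖v - w‖ ^ γ)) *
          (‖u v‖ₑ ^ 2 * ‖g w‖ₑ) := by
          rw [enorm_sq_eq_bracket_mul γ φ v]; ring
      _ ≤ (ENNReal.ofReal (2 ^ (-γ)) *
          (1 + ENNReal.ofReal (‖v - w‖ ^ γ) * ENNReal.ofReal (bracket w ^ (-γ)))) *
          (‖u v‖ₑ ^ 2 * ‖g w‖ₑ) := by gcongr
      _ = _ := by ring
  have hm1 : AEMeasurable (fun z : 𝔼 × 𝔼 => ‖u z.1‖ₑ ^ 2 * ‖g z.2‖ₑ) (volume.prod volume) :=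
    hu.comp_fst.mul hg.enorm.comp_snd
  have hbm : Measurable fun w : 𝔼 => ENNReal.ofReal (bracket w ^ (-γ)) :=
    (measurable_bracket.pow_const _).ennreal_ofReal
  have hm2 : AEMeasurable (fun z : 𝔼 × 𝔼 => ‖u z.1‖ₑ ^ 2 * ENNReal.ofReal (‖z.1 - z.2‖ ^ γ) *
      (ENNReal.ofReal (bracket z.2 ^ (-γ)) * ‖g z.2‖ₑ)) (volume.prod volume) := by
    refine (hu.comp_fst.mul (Measurable.aemeasurable ?_)).mul
      ((hbm.comp measurable_snd).aemeasurable.mul hg.enorm.comp_snd)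
    exact ((measurable_fst.sub measurable_snd).norm.pow_const γ).ennreal_ofReal
  rw [← lintegral_prod_mul hu hg.enorm, ← lintegral_prod _ hm2, ← lintegral_add_left' hm1,
    ← lintegral_const_mul' _ _ ENNReal.ofReal_ne_top,
    lintegral_prod (fun z : 𝔼 × 𝔼 => _ * (_ + _)) ((hm1.add hm2).const_mul _)]
  exact lintegral_mono fun v => lintegral_mono fun w => hpt v w

/-- Passage from extended nonnegative to real estimates. -/
theorem integrable_and_integral_le {f : 𝔼 → ℝ} (hf : AEStronglyMeasurable f volume)
    {T : ℝ≥0∞} (hT : T ≠ ⊤) (hle : ∫⁻ v, ‖f v‖ₑ ≤ T) :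
    Integrable f volume ∧ -∫ v, f v ≤ T.toReal := by
  refine ⟨⟨hf, hle.trans_lt hT.lt_top⟩, ?_⟩
  have h1 := norm_integral_le_lintegral_norm (μ := volume) f
  simp only [ofReal_norm] at h1
  exact (neg_le_abs _).trans (h1.trans (ENNReal.toReal_mono hT hle))

/-- The kernel case `-d < γ < 0`. -/
theorem riesz_estimate (hd : 3 ≤ d) {γ q s : ℝ} (hγd : -(d : ℝ) < γ) (hγ0 : γ < 0)
    (hq : 1 ≤ q) (hs : s = ((d : ℝ) - q * (d + γ)) / (2 * q)) (hs0 : 0 < s) (hs1 : s < 1) :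
    ∃ C₀ : ℝ, 0 < C₀ ∧ ∀ (φ g : 𝔼 → ℝ) (G : 𝔼 → 𝔼),
      IsH1WithGradient (fun v => bracket v ^ (γ / 2) * φ v) G →
      Integrable g → MemWeightedLp q (q * |γ|) g →
      Integrable (fun v => φ v ^ 2 * cCoeff γ g v) ∧
      ∀ ε : ℝ, 0 < ε →
        -∫ v, φ v ^ 2 * cCoeff γ g v ≤
          ε * (∫ v, ‖G v‖ ^ 2) +
            C₀ * ((∫ v, |g v|) +
                ε ^ (-(s / (1 - s))) * weightedLpNorm q (q * |γ|) g ^ (1 / (1 - s))) *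
              ∫ v, φ v ^ 2 * bracket v ^ γ := by
  have hd3 : (3 : ℝ) ≤ d := by exact_mod_cast hd
  obtain ⟨κ, S, hκ, hS, hform⟩ := exists_riesz_form_le hd hγd hγ0 hq hs hs0 hs1
  set c : ℝ := ((d : ℝ) - 1) * (γ + d)
  have hc : 0 < c := mul_pos (by linarith) (by linarith)
  set a : ℝ := c * 2 ^ (-γ)
  have ha : 0 < a := by positivity
  set C₁ : ℝ := a * κ * (a * κ * S) ^ (s / (1 - s))
  -- `a` comes from the `‖g‖₁` term and `C₁` from the optimized Riesz form; the sum serves as a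
  -- common coefficient.
  refine ⟨a + C₁, by positivity, fun φ g G hu hg hgq => ?_⟩
  rw [abs_of_neg hγ0] at hgq ⊢
  set u : 𝔼 → ℝ := fun v => bracket v ^ (γ / 2) * φ v
  set X := ∫ v, φ v ^ 2 * bracket v ^ γ
  set Y := ∫ v, ‖G v‖ ^ 2
  set N := ∫ v, |g v|
  set H := weightedLpNorm q (q * -γ) g
  have hX : ∫⁻ v, ‖u v‖ₑ ^ 2 = ENNReal.ofReal X := by
    rw [lintegral_enorm_sq_eq hu.1, integral_norm_sq_bracket_mul]
  have hX0 : 0 ≤ X := integral_nonneg fun v =>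
    mul_nonneg (by positivity) (Real.rpow_nonneg (bracket_pos v).le _)
  have hY : ∫⁻ v, ‖G v‖ₑ ^ 2 = ENNReal.ofReal Y := lintegral_enorm_sq_eq hu.2.1
  have hY0 : 0 ≤ Y := integral_nonneg fun v => by positivity
  have hN : ∫⁻ v, ‖g v‖ₑ = ENNReal.ofReal N := (ofReal_integral_norm_eq_lintegral_enorm hg).symm
  have hN0 : 0 ≤ N := integral_nonneg fun v => abs_nonneg _
  have hH0 : 0 ≤ H := weightedLpNorm_nonneg _ _ _
  set Tr := ∫⁻ v, ∫⁻ w, ‖u v‖ₑ ^ 2 * ENNReal.ofReal (‖v - w‖ ^ γ) *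
    (ENNReal.ofReal (bracket w ^ (-γ)) * ‖g w‖ₑ)
  have hTr (R : ℝ) (hR : 0 < R) :
      Tr ≤ ENNReal.ofReal (κ * H * (R ^ (-(2 * s)) * (X + R ^ 2 * (S * Y)))) := by
    refine (hform u G (fun w => ENNReal.ofReal (bracket w ^ (-γ)) * ‖g w‖ₑ) hu
      ((measurable_bracket.pow_const _).ennreal_ofReal.aemeasurable.mul
      hg.1.enorm) R hR).trans_eq ?_
    rw [lintegral_weighted_rpow_eq (by linarith) hgq, hX, hY,
      ENNReal.ofReal_mul (mul_nonneg hκ.le hH0), ENNReal.ofReal_mul hκ.le,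
      ENNReal.ofReal_mul (by positivity), ENNReal.ofReal_add hX0 (by positivity),
      ENNReal.ofReal_mul (by positivity), ENNReal.ofReal_mul hS.le]
  -- Any single scale suffices for finiteness, hence for integrability independently of `ε`.
  have hTr_top : Tr ≠ ⊤ := ((hTr 1 one_pos).trans_lt ENNReal.ofReal_lt_top).ne
  have hφm : AEStronglyMeasurable φ volume := aestronglyMeasurable_of_bracket_mul hu.1.1
  have hcoef (v : 𝔼) : cCoeff γ g v = -c * ∫ w, ‖v - w‖ ^ γ * g w := by
    rw [cCoeff, if_neg hγd.ne']
  have hfm : AEStronglyMeasurable (fun v => φ v ^ 2 * cCoeff γ g v) volume := by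
    simp only [hcoef]
    refine (hφm.pow 2).mul (AEStronglyMeasurable.const_mul ?_ _)
    refine AEStronglyMeasurable.integral_prod_right'
      (f := fun z : 𝔼 × 𝔼 => ‖z.1 - z.2‖ ^ γ * g z.2) ?_
    exact ((measurable_fst.sub measurable_snd).norm.pow_const γ).aestronglyMeasurable.mul
      hg.1.comp_snd
  set T : ℝ≥0∞ := ENNReal.ofReal (a * (X * N)) + ENNReal.ofReal a * Tr
  have hle : ∫⁻ v, ‖φ v ^ 2 * cCoeff γ g v‖ₑ ≤ T := by
    calc ∫⁻ v, ‖φ v ^ 2 * cCoeff γ g v‖ₑ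
        ≤ ∫⁻ v, ENNReal.ofReal c *
          ∫⁻ w, ‖φ v‖ₑ ^ 2 * ENNReal.ofReal (‖v - w‖ ^ γ) * ‖g w‖ₑ := by
          refine lintegral_mono fun v => ?_
          simp only [hcoef, mul_assoc]
          rw [lintegral_const_mul' _ _ (by simp), enorm_mul, enorm_mul, enorm_neg, enorm_pow,
            Real.enorm_of_nonneg hc.le, mul_left_comm]
          gcongr
          refine (enorm_integral_le_lintegral_enorm _).trans_eq (lintegral_congr fun w => ?_)
          rw [enorm_mul, Real.enorm_of_nonneg (by positivity)]
      _ = ENNReal.ofReal c *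
          ∫⁻ v, ∫⁻ w, ‖φ v‖ₑ ^ 2 * ENNReal.ofReal (‖v - w‖ ^ γ) * ‖g w‖ₑ :=
          lintegral_const_mul' _ _ (by simp)
      _ ≤ ENNReal.ofReal c * (ENNReal.ofReal (2 ^ (-γ)) *
          ((∫⁻ v, ‖u v‖ₑ ^ 2) * (∫⁻ w, ‖g w‖ₑ) + Tr)) := by
          gcongr
          exact weighted_riesz_form_le hγ0 hu.1.1 hg.1
      _ = T := by
          rw [hX, hN, ← mul_assoc, ← ENNReal.ofReal_mul hc.le, mul_add,
            ← ENNReal.ofReal_mul hX0, ← ENNReal.ofReal_mul ha.le]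
  have hT : T ≠ ⊤ := ENNReal.add_ne_top.2
    ⟨ENNReal.ofReal_ne_top, ENNReal.mul_ne_top ENNReal.ofReal_ne_top hTr_top⟩
  obtain ⟨hint, hbd⟩ := integrable_and_integral_le hfm hT hle
  refine ⟨hint, fun ε hε => hbd.trans ?_⟩
  have hTR : T.toReal = a * (X * N) + a * Tr.toReal := by
    rw [ENNReal.toReal_add ENNReal.ofReal_ne_top
      (ENNReal.mul_ne_top ENNReal.ofReal_ne_top hTr_top), ENNReal.toReal_mul,
      ENNReal.toReal_ofReal (by positivity), ENNReal.toReal_ofReal ha.le]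
  have hopt := le_of_forall_scale (κ := a * κ) (S := S) (T := a * Tr.toReal) (X := X)
    hs0 hs1 (by positivity) hS hH0 hY0 (fun R hR => by
      have h1 := ENNReal.toReal_le_of_le_ofReal (by positivity) (hTr R hR)
      calc a * Tr.toReal ≤ a * (κ * H * (R ^ (-(2 * s)) * (X + R ^ 2 * (S * Y)))) := by gcongr
        _ = _ := by ring) hε
  rw [hTR]
  set E := ε ^ (-(s / (1 - s))) * H ^ (1 / (1 - s))
  have hE : 0 ≤ E := by positivity
  have hC₁ : 0 < C₁ := by positivity
  have hopt' : a * Tr.toReal ≤ ε * Y + C₁ * E * X := hopt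
  have h1 : 0 ≤ a * E * X := by positivity
  have h2 : 0 ≤ C₁ * N * X := by positivity
  calc a * (X * N) + a * Tr.toReal ≤ a * (X * N) + (ε * Y + C₁ * E * X) := by gcongr
    _ ≤ ε * Y + (a + C₁) * (N + E) * X := by
      have : (a + C₁) * (N + E) * X = a * (X * N) + C₁ * E * X + a * E * X + C₁ * N * X := by ring
      linarith

/-- The Coulomb case `γ = -d`. -/
theorem coulomb_estimate (hd : 3 ≤ d) {q : ℝ} (hq : (d : ℝ) / 2 < q) :
    ∃ C₀ : ℝ, 0 < C₀ ∧ ∀ (φ g : 𝔼 → ℝ) (G : 𝔼 → 𝔼),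
      IsH1WithGradient (fun v => bracket v ^ (-(d : ℝ) / 2) * φ v) G →
      MemWeightedLp q (q * d) g →
      Integrable (fun v => φ v ^ 2 * cCoeff (-(d : ℝ)) g v) ∧
      ∀ ε : ℝ, 0 < ε →
        -∫ v, φ v ^ 2 * cCoeff (-(d : ℝ)) g v ≤
          ε * (∫ v, ‖G v‖ ^ 2) +
            C₀ * ε ^ (-((d : ℝ) / (2 * q - d))) *
              weightedLpNorm q (q * d) g ^ (2 * q / (2 * q - d)) *
              ∫ v, φ v ^ 2 * bracket v ^ (-(d : ℝ)) := by
  have hd3 : (3 : ℝ) ≤ d := by exact_mod_cast hd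
  have hd0 : (0 : ℝ) < d := by linarith
  have hq0 : 0 < q := by linarith
  have hq2 : 0 < 2 * q - d := by linarith
  obtain ⟨S, hS, hsob⟩ := exists_lintegral_sq_rpow_le hd
  set s : ℝ := d / (2 * q)
  have hs0 : 0 < s := by positivity
  have hs1 : s < 1 := by rw [div_lt_one (by positivity)]; linarith
  have e1 : s / (1 - s) = d / (2 * q - d) := by simp only [s]; field_simp
  have e2 : 1 / (1 - s) = 2 * q / (2 * q - d) := by simp only [s]; field_simp
  set c : ℝ := ((d : ℝ) - 1) * ((d : ℝ) - 2) * sphereArea d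
  have hc0 : 0 ≤ c := mul_nonneg (mul_nonneg (by linarith) (by linarith)) measureReal_nonneg
  -- Adding 1 gives a positive constant from `0 ≤ c` alone.
  set κ : ℝ := c + 1
  have hκ : 0 < κ := by positivity
  refine ⟨κ * (κ * S) ^ (s / (1 - s)), by positivity, fun φ g G hu hgq => ?_⟩
  set u : 𝔼 → ℝ := fun v => bracket v ^ (-(d : ℝ) / 2) * φ v
  set X := ∫ v, φ v ^ 2 * bracket v ^ (-(d : ℝ))
  set Y := ∫ v, ‖G v‖ ^ 2
  set H := weightedLpNorm q (q * d) g
  have hX : ∫⁻ v, ‖u v‖ₑ ^ 2 = ENNReal.ofReal X := by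
    rw [lintegral_enorm_sq_eq hu.1, integral_norm_sq_bracket_mul]
  have hX0 : 0 ≤ X := integral_nonneg fun v =>
    mul_nonneg (by positivity) (Real.rpow_nonneg (bracket_pos v).le _)
  have hY : ∫⁻ v, ‖G v‖ₑ ^ 2 = ENNReal.ofReal Y := lintegral_enorm_sq_eq hu.2.1
  have hY0 : 0 ≤ Y := integral_nonneg fun v => by positivity
  have hH0 : 0 ≤ H := weightedLpNorm_nonneg _ _ _
  set h : 𝔼 → ℝ≥0∞ := fun w => ENNReal.ofReal (bracket w ^ (d : ℝ)) * ‖g w‖ₑ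
  have hh : AEMeasurable h volume :=
    (measurable_bracket.pow_const _).ennreal_ofReal.aemeasurable.mul hgq.1.enorm
  -- With `s = d/(2q)` this is `1 - 1/q`, so `u²` is measured in the space dual to `L^q`.
  set P : ℝ := 1 - 2 * s / d
  have hPq : P = 1 - 1 / q := by simp only [P, s]; field_simp
  have hP0 : 0 < P := by
    rw [hPq, sub_pos, div_lt_one hq0]; linarith
  set T := ∫⁻ v, ‖u v‖ₑ ^ 2 * h v
  have hT (R : ℝ) (hR : 0 < R) :
      T ≤ ENNReal.ofReal (H * (R ^ (-(2 * s)) * (X + R ^ 2 * (S * Y)))) := by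
    have hh1 := ENNReal.lintegral_mul_norm_pow_le (μ := (volume : Measure 𝔼))
      ((hu.1.1.enorm.pow_const 2).pow_const P⁻¹) (hh.pow_const q) hP0.le
      (by positivity : 0 ≤ 1 / q) (by rw [hPq]; ring)
    simp only [← ENNReal.rpow_mul, inv_mul_cancel₀ hP0.ne', mul_one_div_cancel hq0.ne',
      ENNReal.rpow_one] at hh1
    -- At `θ = s` the power of `R` on the left is trivial, so `R` enters only through the splitting
    -- of the geometric mean.
    have h2 := rpow_mul_rpow_le_scaled_add (s := s) hs0.le hs1.le hR (ENNReal.ofReal X)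
      (ENNReal.ofReal S * ENNReal.ofReal Y)
    rw [sub_self, Real.rpow_zero, ENNReal.ofReal_one, one_mul] at h2
    have h3 := hsob u G hu s P hs0.le hs1.le rfl
    rw [hX, hY] at h3
    calc T ≤ (∫⁻ v, (‖u v‖ₑ ^ 2) ^ P⁻¹) ^ P * (∫⁻ w, h w ^ q) ^ (1 / q) := hh1
      _ ≤ (ENNReal.ofReal (R ^ (-(2 * s))) * (ENNReal.ofReal X +
          ENNReal.ofReal (R ^ 2) * (ENNReal.ofReal S * ENNReal.ofReal Y))) *
          (∫⁻ w, h w ^ q) ^ (1 / q) := by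
          gcongr
          exact h3.trans h2
      _ = _ := by
          rw [lintegral_weighted_rpow_eq hq0 hgq, mul_comm,
            ENNReal.ofReal_mul hH0, ENNReal.ofReal_mul (by positivity),
            ENNReal.ofReal_add hX0 (by positivity),
            ENNReal.ofReal_mul (by positivity), ENNReal.ofReal_mul hS.le]
  have hT_top : T ≠ ⊤ := ((hT 1 one_pos).trans_lt ENNReal.ofReal_lt_top).ne
  have hcoef (v : 𝔼) : cCoeff (-(d : ℝ)) g v = -c * g v := by
    rw [cCoeff, if_pos rfl]
  have hfm : AEStronglyMeasurable (fun v => φ v ^ 2 * cCoeff (-(d : ℝ)) g v) volume := by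
    simp only [hcoef]
    exact ((aestronglyMeasurable_of_bracket_mul hu.1.1).pow 2).mul (hgq.1.const_mul _)
  have hle : ∫⁻ v, ‖φ v ^ 2 * cCoeff (-(d : ℝ)) g v‖ₑ ≤ ENNReal.ofReal κ * T := by
    rw [← lintegral_const_mul' _ _ (by simp)]
    refine lintegral_mono fun v => ?_
    simp only [hcoef, enorm_mul, enorm_neg, enorm_pow]
    rw [enorm_sq_eq_bracket_mul (-(d : ℝ)) φ v, neg_neg, Real.enorm_of_nonneg hc0]
    calc _ = ENNReal.ofReal c * (‖u v‖ₑ ^ 2 * h v) := by simp only [h, u]; ring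
      _ ≤ _ := by
        gcongr
        simp only [κ]
        linarith
  obtain ⟨hint, hbd⟩ := integrable_and_integral_le hfm
    (ENNReal.mul_ne_top ENNReal.ofReal_ne_top hT_top) hle
  refine ⟨hint, fun ε hε => hbd.trans ?_⟩
  rw [ENNReal.toReal_mul, ENNReal.toReal_ofReal hκ.le]
  have hopt := le_of_forall_scale (κ := κ) (S := S) (T := κ * T.toReal) (X := X)
    hs0 hs1 hκ hS hH0 hY0 (fun R hR => by
      have h1 := ENNReal.toReal_le_of_le_ofReal (by positivity) (hT R hR)
      calc κ * T.toReal ≤ κ * (H * (R ^ (-(2 * s)) * (X + R ^ 2 * (S * Y)))) := by gcongr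
        _ = _ := by ring) hε
  refine hopt.trans_eq ?_
  rw [e1, e2]
  ring

end Landau

end

theorem proposition3p4 (d : ℕ) (hd : 3 ≤ d) :
    (∀ γ q s : ℝ, -(d : ℝ) < γ → γ < 0 → 1 ≤ q →
      (d : ℝ) / (d + 2 + γ) < q → q < (d : ℝ) / (d + γ) →
      s = ((d : ℝ) - q * (d + γ)) / (2 * q) →
      (0 < s ∧ s < 1) ∧
      ∃ C₀ : ℝ, 0 < C₀ ∧
        ∀ (φ g : EuclideanSpace ℝ (Fin d) → ℝ)
          (G : EuclideanSpace ℝ (Fin d) → EuclideanSpace ℝ (Fin d)),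
          Landau.IsH1WithGradient (fun v => Landau.bracket v ^ (γ / 2) * φ v) G →
          (∀ᵐ v, 0 ≤ g v) → Integrable g → Landau.MemWeightedLp q (q * |γ|) g →
          (∀ᵐ v : EuclideanSpace ℝ (Fin d), Integrable (fun w => ‖v - w‖ ^ γ * g w)) ∧
          Integrable (fun v => φ v ^ 2 * Landau.cCoeff γ g v) ∧
          ∀ ε : ℝ, 0 < ε →
            -∫ v, φ v ^ 2 * Landau.cCoeff γ g v ≤
              ε * (∫ v, ‖G v‖ ^ 2) +
                C₀ * ((∫ v, |g v|) +
                    ε ^ (-(s / (1 - s))) *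
                      Landau.weightedLpNorm q (q * |γ|) g ^ (1 / (1 - s))) *
                  ∫ v, φ v ^ 2 * Landau.bracket v ^ γ) ∧
    (∀ q : ℝ, (d : ℝ) / 2 < q →
      ∃ C₀ : ℝ, 0 < C₀ ∧
        ∀ (φ g : EuclideanSpace ℝ (Fin d) → ℝ)
          (G : EuclideanSpace ℝ (Fin d) → EuclideanSpace ℝ (Fin d)),
          Landau.IsH1WithGradient (fun v => Landau.bracket v ^ (-(d : ℝ) / 2) * φ v) G →
          (∀ᵐ v, 0 ≤ g v) → Landau.MemWeightedLp q (q * d) g →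
          Integrable (fun v => φ v ^ 2 * Landau.cCoeff (-(d : ℝ)) g v) ∧
          ∀ ε : ℝ, 0 < ε →
            -∫ v, φ v ^ 2 * Landau.cCoeff (-(d : ℝ)) g v ≤
              ε * (∫ v, ‖G v‖ ^ 2) +
                C₀ * ε ^ (-((d : ℝ) / (2 * q - d))) *
                  Landau.weightedLpNorm q (q * d) g ^ (2 * q / (2 * q - d)) *
                  ∫ v, φ v ^ 2 * Landau.bracket v ^ (-(d : ℝ))) := by
  have hd3 : (3 : ℝ) ≤ d := by exact_mod_cast hd
  refine ⟨fun γ q s hγd hγ0 hq hq1 hq2 hs => ?_, fun q hq => ?_⟩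
  · have hq0 : 0 < q := by linarith
    rw [div_lt_iff₀ (by linarith)] at hq1
    rw [lt_div_iff₀ (by linarith)] at hq2
    -- The upper bound on `q` is equivalent to `0 < s`, the lower one to `s < 1`.
    have hs0 : 0 < s := by
      rw [hs]
      exact div_pos (by linarith) (by linarith)
    have hs1 : s < 1 := by
      rw [hs, div_lt_one (by linarith)]
      linarith
    obtain ⟨C₀, hC₀, h⟩ := Landau.riesz_estimate hd hγd hγ0 hq hs hs0 hs1
    exact ⟨⟨hs0, hs1⟩, C₀, hC₀, fun φ g G hu _ hg hgq =>
      ⟨Landau.ae_integrable_riesz hd hγd hγ0 hg, h φ g G hu hg hgq⟩⟩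
  · obtain ⟨C₀, hC₀, h⟩ := Landau.coulomb_estimate hd hq
    exact ⟨C₀, hC₀, fun φ g G hu _ hgq => h φ g G hu hgq⟩
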